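/- Let $M\subset\mathbf R^s$ be a compact $m$-dimensional smooth submanifold without boundary. Let the cutlocus $C$ of $M$ be the set of all $x\in\mathbf R^s$ for which either the minimiser over $M$ of $L_x(\mu)=\|\mu-x\|^2$ is not unique, or the function $L_x$ on $M$ has a degenerate second derivative (Hessian) at this minimiser. For $x\in\mathbf R^s\setminus C$ let $\pi(x)\in M$ be the unique nearest point of $M$ to $x$. Let $d(x,A)$ be the Euclidean distance from $x$ to the set $A$ (with $d(x,\emptyset)=+\infty$). Let $t_n\in\mathbf R^s$ be a sequence of points, let $\tilde t_n$ be random vectors in $\mathbf R^s$ (possibly defined on different probability spaces), and let $B_n$ be nonsingular real $s\times s$ matrices with $B_n\to 0$, such that $$B_n^{-1}(\tilde t_n-t_n)\xrightarrow{\mathcal D} Z\qquad (n\to\infty)$$ for some random vector $Z$ in $\mathbf R^s$. Suppose that $t_n\notin C$ for all $n$, that there is $D>0$ with $d(t_n,M)\le D$ for all $n$, and that $$\frac{B_n}{d(t_n,C)}\to 0 .$$ Put $\mu_n=\pi(t_n)$ and let $\tilde\mu_n$ be equal to $\pi(\tilde t_n)$ on the event $\tilde t_n\notin C$ and arbitrary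 on the event $\tilde t_n\in C$. Then $\|\tilde\mu_n-\mu_n\|\to 0$ in probability, that is, $\mathbf P(\|\tilde\mu_n-\mu_n\|\ge\varepsilon)\to 0$ for every $\varepsilon>0$ (in the sense of outer probability if $\tilde\mu_n$ is not measurable). -/

import Mathlib

open MeasureTheory Filter Topology

/-- `y` is a point of `M` at minimal distance from `x`, i.e. a minimiser over `M` of the distance
(equivalently of the squared distance) to `x`. -/
def IsNearestPoint {s : ℕ} (M : Set (EuclideanSpace ℝ (Fin s))) (x y : EuclideanSpace ℝ (Fin s)) :
    Prop :=
  y ∈ M ∧ ∀ z ∈ M, ‖y - x‖ ^ 2 ≤ ‖z - x‖ ^ 2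

/-- The nearest-point mapping: the nearest point of `M` where it is unique (and a selection of a
nearest point where there are several). -/
noncomputable def nearestPoint {s : ℕ} (M : Set (EuclideanSpace ℝ (Fin s)))
    (x : EuclideanSpace ℝ (Fin s)) : EuclideanSpace ℝ (Fin s) :=
  Classical.epsilon (IsNearestPoint M x)

/-- `φ`, restricted to the open set `V ⊆ ℝᵐ`, is a smooth local parametrisation of `M ⊆ ℝˢ`: an
immersion that is a homeomorphism onto a relatively open subset of `M`. -/
structure IsLocalParam {s : ℕ} (m : ℕ) (M : Set (EuclideanSpace ℝ (Fin s)))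
    (φ : EuclideanSpace ℝ (Fin m) → EuclideanSpace ℝ (Fin s))
    (V : Set (EuclideanSpace ℝ (Fin m))) : Prop where
  isOpen : IsOpen V
  contDiffOn : ContDiffOn ℝ (⊤ : ℕ∞) φ V
  injective_fderiv : ∀ u ∈ V, Function.Injective (fderiv ℝ φ u)
  isEmbedding : IsEmbedding (V.domRestrict φ)
  image_eq : ∃ U : Set (EuclideanSpace ℝ (Fin s)), IsOpen U ∧ φ '' V = M ∩ U

/-- `M` is an `m`-dimensional smooth (embedded) submanifold of `ℝˢ`, without boundary. -/
def IsSubmanifold {s : ℕ} (m : ℕ) (M : Set (EuclideanSpace ℝ (Fin s))) : Prop :=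
  ∀ p ∈ M, ∃ φ V, IsLocalParam m M φ V ∧ p ∈ φ '' V

/-- The second derivative (Hessian) of `f` on the `m`-dimensional submanifold `M` at the point `p`,
computed in a local parametrisation around `p`, is a nondegenerate bilinear form. At a critical
point of `f` on `M`, such as a minimiser, this does not depend on the parametrisation. -/
def NondegenerateHessianAt {s : ℕ} (m : ℕ) (M : Set (EuclideanSpace ℝ (Fin s)))
    (f : EuclideanSpace ℝ (Fin s) → ℝ) (p : EuclideanSpace ℝ (Fin s)) : Prop :=
  ∃ φ V, IsLocalParam m M φ V ∧ ∃ u ∈ V, φ u = p ∧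
    ∀ v, (∀ w, fderiv ℝ (fderiv ℝ (f ∘ φ)) u v w = 0) → v = 0

/-- The cutlocus of the `m`-dimensional submanifold `M`: the points `x` whose nearest point on `M`
is not uniquely defined, or for which the squared distance to `x` on `M` has a degenerate second
derivative at the nearest point. -/
def cutLocus {s : ℕ} (m : ℕ) (M : Set (EuclideanSpace ℝ (Fin s))) :
    Set (EuclideanSpace ℝ (Fin s)) :=
  {x | (¬ ∃! y, IsNearestPoint M x y) ∨
    ¬ NondegenerateHessianAt m M (fun y => ‖y - x‖ ^ 2) (nearestPoint M x)}

/-! The theorem reduces to a deterministic estimate (`norm_sub_le_of_disjoint_ball`): if the ball of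
radius `r` about `x` misses the cutlocus and the nearest point `p` of `x` has `‖x - p‖ ≤ D`, then
any nearest point `p'` of any `x'` satisfies `‖p' - p‖ ≤ 2 (1 + 2D/r) ‖x' - x‖`. By tightness, `‖tt
n - t n‖ ≤ K ‖B n‖` with probability close to 1, and both `‖B n‖` and `‖B n‖ / r n` tend to 0.

The estimate holds because `p` stays nearest along the ray from `p` through `x` until that ray meets
the cutlocus (`forall_inner_le_of_disjoint_ball`): off the cutlocus, uniqueness and nondegeneracy
give quadratic growth, which leaves room to go further. Being nearest to a point beyond `x` gives a
quantitative gap at `x`. Taking `r` to be the distance to the cutlocus requires this distance to be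
positive, hence `isClosed_cutLocus`. -/

/-! ### Second order conditions at a minimum. -/

section SecondOrder

variable {E : Type*} [NormedAddCommGroup E] [NormedSpace ℝ E] {f : E → ℝ} {u₀ : E}

/-- Second order Taylor expansion at a critical point, with Peano remainder. -/
lemma ContDiffAt.eventually_abs_sub_half_fderiv_fderiv_le (hf : ContDiffAt ℝ 2 f u₀)
    (h0 : fderiv ℝ f u₀ = 0) {ε : ℝ} (hε : 0 < ε) :
    ∀ᶠ u in 𝓝 u₀, |f u - f u₀ - 2⁻¹ * fderiv ℝ (fderiv ℝ f) u₀ (u - u₀) (u - u₀)| ≤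
      ε * ‖u - u₀‖ ^ 2 := by
  set H := fderiv ℝ (fderiv ℝ f) u₀ with hH
  have hsymm : ∀ v w, H v w = H w v := hf.isSymmSndFDerivAt (by simp)
  have hd : HasFDerivAt (fderiv ℝ f) H u₀ :=
    ((hf.fderiv_right (m := 1) (by norm_num)).differentiableAt (by norm_num)).hasFDerivAt
  have hlo := (hasFDerivAt_iff_isLittleO.1 hd).bound hε
  have hdiff : ∀ᶠ u in 𝓝 u₀, DifferentiableAt ℝ f u :=
    (hf.eventually (by simp)).mono fun u hu => hu.differentiableAt (by norm_num)
  obtain ⟨r, hr, hball⟩ := Metric.eventually_nhds_iff_ball.1 (hlo.and hdiff)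
  filter_upwards [Metric.ball_mem_nhds u₀ hr] with u hu
  have hsub : ∀ v ∈ Metric.closedBall u₀ ‖u - u₀‖, v ∈ Metric.ball u₀ r := fun v hv =>
    lt_of_le_of_lt hv (by simpa [dist_eq_norm] using hu)
  -- Mean value inequality for `f` minus its quadratic model, whose derivative is at most `ε * ‖u -
  -- u₀‖` on this ball.
  have key := Convex.norm_image_sub_le_of_norm_hasFDerivWithin_le
    (f := fun v => f v - 2⁻¹ * H (v - u₀) (v - u₀)) (x := u₀) (y := u)
    (f' := fun v => fderiv ℝ f v - H (v - u₀)) (C := ε * ‖u - u₀‖)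
    (s := Metric.closedBall u₀ ‖u - u₀‖) ?_ ?_ (convex_closedBall _ _)
    (Metric.mem_closedBall_self (norm_nonneg _)) (by simp [dist_eq_norm])
  · simp only [sub_self, map_zero, mul_zero, sub_zero, Real.norm_eq_abs] at key
    rw [show f u - f u₀ - 2⁻¹ * H (u - u₀) (u - u₀) =
      f u - 2⁻¹ * H (u - u₀) (u - u₀) - f u₀ by ring]
    calc _ ≤ _ := key
      _ = _ := by ring
  · intro v hv
    have h1 := (hball v (hsub v hv)).2.hasFDerivAt
    have h2 : HasFDerivAt (fun v : E => v - u₀) (ContinuousLinearMap.id ℝ E) v :=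
      (hasFDerivAt_id v).sub_const u₀
    have h3 : HasFDerivAt (fun v => H (v - u₀)) H v := H.hasFDerivAt.comp v h2
    have h4 := ((h3.clm_apply h2).const_mul 2⁻¹)
    refine ((h1.sub h4).congr_fderiv ?_).hasFDerivWithinAt
    ext w
    have := hsymm w (v - u₀)
    simp only [sub_apply, smul_apply,
      add_apply, ContinuousLinearMap.comp_apply, ContinuousLinearMap.id_apply,
      ContinuousLinearMap.flip_apply, smul_eq_mul, this]
    ring
  · intro v hv
    have := (hball v (hsub v hv)).1
    rw [h0, sub_zero] at this
    refine this.trans ?_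
    have : ‖v - u₀‖ ≤ ‖u - u₀‖ := by simpa [dist_eq_norm] using hv
    gcongr

/-- Second order necessary condition for a local minimum. -/
lemma IsLocalMin.fderiv_fderiv_nonneg (hmin : IsLocalMin f u₀) (hf : ContDiffAt ℝ 2 f u₀) (v : E) :
    0 ≤ fderiv ℝ (fderiv ℝ f) u₀ v v := by
  by_contra! hneg
  set H := fderiv ℝ (fderiv ℝ f) u₀
  have hv : v ≠ 0 := by rintro rfl; simp at hneg
  have hv2 : 0 < ‖v‖ ^ 2 := by positivity
  -- With this `ε` the remainder along `v` is at most half of the negative quadratic term.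
  have hε : 0 < -(H v v) / (4 * ‖v‖ ^ 2) := div_pos (by linarith) (by positivity)
  have hT := (hf.eventually_abs_sub_half_fderiv_fderiv_le hmin.fderiv_eq_zero hε).and hmin
  have htend : Tendsto (fun τ : ℝ => u₀ + τ • v) (𝓝[>] 0) (𝓝 u₀) := by
    have : Continuous fun τ : ℝ => u₀ + τ • v := by fun_prop
    simpa using (this.tendsto 0).mono_left nhdsWithin_le_nhds
  obtain ⟨τ, ⟨h1, h2⟩, h3⟩ := ((htend.eventually hT).and self_mem_nhdsWithin).exists
  have hτ : (0 : ℝ) < τ := h3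
  simp only [add_sub_cancel_left, map_smul, smul_apply, smul_eq_mul, norm_smul,
    Real.norm_eq_abs, mul_pow, sq_abs] at h1
  have h4 := (abs_le.1 h1).2
  have h5 : -(H v v) / (4 * ‖v‖ ^ 2) * (τ ^ 2 * ‖v‖ ^ 2) = -(H v v) * τ ^ 2 / 4 := by
    field_simp
  change f (u₀ + τ • v) - f u₀ - 2⁻¹ * (τ * (τ * H v v)) ≤ _ at h4
  rw [h5] at h4
  nlinarith [mul_pos_of_neg_of_neg hneg (by nlinarith : -(τ ^ 2) < 0)]

/-- At a local minimum with nondegenerate second derivative, the second derivative is coercive. -/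
lemma IsLocalMin.exists_coercive_fderiv_fderiv [FiniteDimensional ℝ E] (hmin : IsLocalMin f u₀)
    (hf : ContDiffAt ℝ 2 f u₀)
    (hnd : ∀ v, (∀ w, fderiv ℝ (fderiv ℝ f) u₀ v w = 0) → v = 0) :
    ∃ c > 0, ∀ v, c * ‖v‖ ^ 2 ≤ fderiv ℝ (fderiv ℝ f) u₀ v v := by
  set H := fderiv ℝ (fderiv ℝ f) u₀
  have hsymm : ∀ v w, H v w = H w v := hf.isSymmSndFDerivAt (by simp)
  have hnn : ∀ v, 0 ≤ H v v := hmin.fderiv_fderiv_nonneg hf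
  have hpos : ∀ v, v ≠ 0 → 0 < H v v := by
    intro v hv
    refine lt_of_le_of_ne (hnn v) fun h => hv (hnd v fun w => ?_)
    by_contra hne
    -- A null vector of a nonnegative form lies in its kernel: otherwise this `a` makes the form
    -- equal to `-H w w - 2` at `w - a • v`.
    obtain ⟨a, ha⟩ : ∃ a, a * H v w = H w w + 1 := ⟨(H w w + 1) / H v w, by field_simp⟩
    have h1 := hnn (w - a • v)
    simp only [map_sub, map_smul, sub_apply, smul_apply, smul_eq_mul,
      ← h, hsymm w v] at h1
    linarith [hnn w]
  rcases subsingleton_or_nontrivial E with hE | hE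
  · exact ⟨1, one_pos, fun v => by simp [Subsingleton.elim v 0]⟩
  · have hcomp : IsCompact (Metric.sphere (0 : E) 1) := isCompact_sphere 0 1
    obtain ⟨v₀, hv₀, hle⟩ := hcomp.exists_isMinOn (NormedSpace.sphere_nonempty.2 zero_le_one)
      (f := fun v => H v v) (by fun_prop)
    have hv₀' : v₀ ≠ 0 := ne_zero_of_mem_unit_sphere ⟨v₀, hv₀⟩
    refine ⟨H v₀ v₀, hpos v₀ hv₀', fun v => ?_⟩
    rcases eq_or_ne v 0 with rfl | hv
    · simp
    have hn : 0 < ‖v‖ := norm_pos_iff.2 hv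
    have h1 : H v₀ v₀ ≤ H (‖v‖⁻¹ • v) (‖v‖⁻¹ • v) := hle (by simp [norm_smul, hn.ne'])
    simp only [map_smul, smul_apply, smul_eq_mul] at h1
    calc H v₀ v₀ * ‖v‖ ^ 2 ≤ (‖v‖⁻¹ * (‖v‖⁻¹ * H v v)) * ‖v‖ ^ 2 := by gcongr
      _ = H v v := by field_simp

/-- Quadratic growth at a nondegenerate local minimum. -/
lemma IsLocalMin.exists_quadratic_growth [FiniteDimensional ℝ E] (hmin : IsLocalMin f u₀)
    (hf : ContDiffAt ℝ 2 f u₀)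
    (hnd : ∀ v, (∀ w, fderiv ℝ (fderiv ℝ f) u₀ v w = 0) → v = 0) :
    ∃ c > 0, ∀ᶠ u in 𝓝 u₀, f u₀ + c * ‖u - u₀‖ ^ 2 ≤ f u := by
  obtain ⟨c, hc, hH⟩ := hmin.exists_coercive_fderiv_fderiv hf hnd
  refine ⟨c / 4, by positivity, ?_⟩
  filter_upwards [hf.eventually_abs_sub_half_fderiv_fderiv_le hmin.fderiv_eq_zero
    (ε := c / 4) (by positivity)] with u hu
  have := (abs_le.1 hu).1
  have := hH (u - u₀)
  linarith

end SecondOrder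

/-! ### Comparing squared distances in an inner product space. -/

section Projection

variable {F : Type*} [NormedAddCommGroup F] [InnerProductSpace ℝ F]

/-- The centre `x` enters the right side only through a term linear in `x - p`, so moving along the
ray from `p` just rescales that term. -/
lemma norm_sub_sq_sub_norm_sub_sq (x p z : F) :
    ‖z - x‖ ^ 2 - ‖p - x‖ ^ 2 = ‖z - p‖ ^ 2 - 2 * inner ℝ (x - p) (z - p) := by
  have : z - x = (z - p) - (x - p) := by abel
  rw [this, norm_sub_sq_real, norm_sub_rev p x, real_inner_comm]
  ring

/-- Stability of nearest points: `p` is assumed to be nearest to the point `p + Λ (x - p)` of the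
ray from `p` through `x`, in the direction of `p'`, and `p'` is at least as near to `x'` as `p`. -/
lemma norm_sub_le_of_inner_le {x x' p p' : F} {Λ : ℝ} (hΛ : 0 < Λ)
    (h : 2 * Λ * inner ℝ (x - p) (p' - p) ≤ ‖p' - p‖ ^ 2) (h' : ‖p' - x'‖ ^ 2 ≤ ‖p - x'‖ ^ 2) :
    (1 - Λ⁻¹) * ‖p' - p‖ ≤ 2 * ‖x' - x‖ := by
  have h1 := norm_sub_sq_sub_norm_sub_sq x' p p'
  have h2 : 2 * inner ℝ (x - p) (p' - p) ≤ Λ⁻¹ * ‖p' - p‖ ^ 2 := by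
    rw [inv_mul_eq_div, le_div_iff₀ hΛ]; linarith
  have h3 : inner ℝ (x' - p) (p' - p) = inner ℝ (x' - x) (p' - p) + inner ℝ (x - p) (p' - p) := by
    rw [← inner_add_left]; simp
  have h4 := real_inner_le_norm (x' - x) (p' - p)
  rcases (norm_nonneg (p' - p)).eq_or_lt with h0 | h0
  · rw [← h0]; simp
  · refine le_of_mul_le_mul_right ?_ h0
    nlinarith

end Projection

/-! ### Local parametrisations and nearest points. -/

section Submanifold

variable {s m : ℕ} {M : Set (EuclideanSpace ℝ (Fin s))} {x y p : EuclideanSpace ℝ (Fin s)}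
  {φ : EuclideanSpace ℝ (Fin m) → EuclideanSpace ℝ (Fin s)} {V : Set (EuclideanSpace ℝ (Fin m))}
  {u : EuclideanSpace ℝ (Fin m)}

/-- The embedding property and relative openness exclude other sheets of `M` near `φ u`: ambient
closeness forces closeness of parameters. -/
lemma IsLocalParam.exists_inter_subset_image (hφ : IsLocalParam m M φ V) (hu : u ∈ V)
    {N : Set (EuclideanSpace ℝ (Fin m))} (hN : N ∈ 𝓝 u) :
    ∃ U ∈ 𝓝 (φ u), M ∩ U ⊆ φ '' (V ∩ N) := by
  obtain ⟨U₁, hU₁, hUeq⟩ := hφ.image_eq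
  have h1 : (Subtype.val ⁻¹' N : Set V) ∈ 𝓝 (⟨u, hu⟩ : V) := continuousAt_subtype_val hN
  rw [hφ.isEmbedding.nhds_eq_comap, mem_comap] at h1
  obtain ⟨O, hO, hON⟩ := h1
  have hu1 : φ u ∈ U₁ := (hUeq ▸ Set.mem_image_of_mem φ hu : φ u ∈ M ∩ U₁).2
  refine ⟨U₁ ∩ O, inter_mem (hU₁.mem_nhds hu1) hO, ?_⟩
  rintro z ⟨hzM, hzU, hzO⟩
  obtain ⟨v, hv, rfl⟩ : z ∈ φ '' V := hUeq ▸ ⟨hzM, hzU⟩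
  exact ⟨v, ⟨hv, hON (show (⟨v, hv⟩ : V) ∈ V.domRestrict φ ⁻¹' O from hzO)⟩, rfl⟩

lemma IsLocalParam.mem (hφ : IsLocalParam m M φ V) (hu : u ∈ V) : φ u ∈ M := by
  obtain ⟨U, -, hU⟩ := hφ.image_eq
  exact (hU ▸ Set.mem_image_of_mem φ hu : φ u ∈ M ∩ U).1

lemma IsLocalParam.contDiffAt (hφ : IsLocalParam m M φ V) (hu : u ∈ V) :
    ContDiffAt ℝ 2 φ u :=
  (hφ.contDiffOn.contDiffAt (hφ.isOpen.mem_nhds hu)).of_le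
    (WithTop.coe_le_coe.2 (le_top : (2 : ℕ∞) ≤ ⊤))

lemma IsLocalParam.contDiffAt_sqDist (hφ : IsLocalParam m M φ V) (hu : u ∈ V)
    (x : EuclideanSpace ℝ (Fin s)) :
    ContDiffAt ℝ 2 ((fun y => ‖y - x‖ ^ 2) ∘ φ) u :=
  ((hφ.contDiffAt hu).sub contDiffAt_const).norm_sq ℝ

lemma IsLocalParam.isLocalMin_sqDist (hφ : IsLocalParam m M φ V) (hu : u ∈ V)
    (h : IsNearestPoint M x (φ u)) : IsLocalMin ((fun y => ‖y - x‖ ^ 2) ∘ φ) u := by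
  filter_upwards [hφ.isOpen.mem_nhds hu] with v hv
  exact h.2 _ (hφ.mem hv)

/-- Moving the centre of the squared distance changes the differential of its pull-back by a term
that is linear in the displacement. -/
lemma IsLocalParam.fderiv_sqDist_eq (hφ : IsLocalParam m M φ V) (hu : u ∈ V)
    (x y : EuclideanSpace ℝ (Fin s)) :
    fderiv ℝ ((fun z => ‖z - y‖ ^ 2) ∘ φ) u = fderiv ℝ ((fun z => ‖z - x‖ ^ 2) ∘ φ) u +
      (2 • innerSL ℝ (x - y)) ∘SL fderiv ℝ φ u := by
  have hd : HasFDerivAt φ (fderiv ℝ φ u) u :=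
    ((hφ.contDiffAt hu).differentiableAt (by simp)).hasFDerivAt
  have key : ∀ a, HasFDerivAt ((fun z => ‖z - a‖ ^ 2) ∘ φ)
      (2 • (innerSL ℝ (φ u - a)) ∘SL fderiv ℝ φ u) u := fun a => (hd.sub_const a).norm_sq
  rw [(key x).fderiv, (key y).fderiv]
  ext w
  simp
  ring

lemma isNearestPoint_iff : IsNearestPoint M x p ↔
    p ∈ M ∧ ∀ z ∈ M, 2 * inner ℝ (x - p) (z - p) ≤ ‖z - p‖ ^ 2 := by
  refine and_congr_right fun _ => forall₂_congr fun z _ => ?_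
  have := norm_sub_sq_sub_norm_sub_sq x p z
  constructor <;> intro <;> linarith

lemma exists_isNearestPoint (hMc : IsCompact M) (hne : M.Nonempty)
    (x : EuclideanSpace ℝ (Fin s)) : ∃ p, IsNearestPoint M x p := by
  obtain ⟨p, hp, hmin⟩ := hMc.exists_isMinOn hne (f := fun z => ‖z - x‖ ^ 2) (by fun_prop)
  exact ⟨p, hp, fun z hz => hmin hz⟩

lemma isNearestPoint_nearestPoint (hMc : IsCompact M) (hne : M.Nonempty)
    (x : EuclideanSpace ℝ (Fin s)) : IsNearestPoint M x (nearestPoint M x) :=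
  Classical.epsilon_spec (exists_isNearestPoint hMc hne x)

lemma notMem_cutLocus_iff : x ∉ cutLocus m M ↔ ∃ p, IsNearestPoint M x p ∧
    (∀ q, IsNearestPoint M x q → q = p) ∧
      NondegenerateHessianAt m M (fun y => ‖y - x‖ ^ 2) p := by
  simp only [cutLocus, Set.mem_ofPred_eq, not_or, not_not]
  constructor
  · rintro ⟨⟨p, hp, hq⟩, h⟩
    have : nearestPoint M x = p := hq _ (Classical.epsilon_spec (p := IsNearestPoint M x) ⟨p, hp⟩)
    exact ⟨p, hp, hq, this ▸ h⟩
  · rintro ⟨p, hp, hq, h⟩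
    have : nearestPoint M x = p := hq _ (Classical.epsilon_spec (p := IsNearestPoint M x) ⟨p, hp⟩)
    exact ⟨⟨p, hp, hq⟩, this ▸ h⟩

/-! ### Quadratic growth, normal rays and closedness of the cutlocus. -/

/-- Off the cutlocus, the squared distance grows quadratically away from the nearest point. -/
lemma exists_quadratic_growth (hMc : IsCompact M) (hp : IsNearestPoint M x p)
    (huniq : ∀ q, IsNearestPoint M x q → q = p)
    (hnd : NondegenerateHessianAt m M (fun y => ‖y - x‖ ^ 2) p) :
    ∃ c > 0, ∀ z ∈ M, 2 * inner ℝ (x - p) (z - p) ≤ (1 - c) * ‖z - p‖ ^ 2 := by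
  obtain ⟨φ, V, hφ, u₀, hu₀, rfl, hnd⟩ := hnd
  suffices ∃ c > 0, ∀ z ∈ M, c * ‖z - φ u₀‖ ^ 2 ≤ ‖z - x‖ ^ 2 - ‖φ u₀ - x‖ ^ 2 by
    obtain ⟨c, hc, h⟩ := this
    refine ⟨c, hc, fun z hz => ?_⟩
    have := norm_sub_sq_sub_norm_sub_sq x (φ u₀) z
    linarith [h z hz]
  obtain ⟨c, hc, hgrow⟩ := (hφ.isLocalMin_sqDist hu₀ hp).exists_quadratic_growth
    (hφ.contDiffAt_sqDist hu₀ x) hnd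
  obtain ⟨K, N, hN, hlip⟩ :=
    ((hφ.contDiffAt hu₀).hasStrictFDerivAt (by simp)).exists_lipschitzOnWith
  obtain ⟨U, hU, hMU⟩ := hφ.exists_inter_subset_image hu₀ (inter_mem hN hgrow)
  -- Growth in the parameter becomes growth in `M` through the Lipschitz constant of `φ`; the `+ 1`
  -- covers `K = 0`.
  have hnear : ∀ z ∈ M ∩ U,
      c / (K ^ 2 + 1) * ‖z - φ u₀‖ ^ 2 ≤ ‖z - x‖ ^ 2 - ‖φ u₀ - x‖ ^ 2 := by
    intro z hz
    obtain ⟨v, ⟨-, hvN, hv⟩, rfl⟩ := hMU hz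
    have h1 : ‖φ v - φ u₀‖ ≤ K * ‖v - u₀‖ := by
      simpa [dist_eq_norm] using hlip.dist_le_mul v hvN u₀ (mem_of_mem_nhds hN)
    have h2 : ‖φ v - φ u₀‖ ^ 2 ≤ (K ^ 2 + 1) * ‖v - u₀‖ ^ 2 :=
      calc _ ≤ (K * ‖v - u₀‖) ^ 2 := by gcongr
        _ ≤ _ := by rw [mul_pow]; gcongr; linarith
    have h3 : ‖φ u₀ - x‖ ^ 2 + c * ‖v - u₀‖ ^ 2 ≤ ‖φ v - x‖ ^ 2 := hv
    calc c / (K ^ 2 + 1) * ‖φ v - φ u₀‖ ^ 2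
        ≤ c / (K ^ 2 + 1) * ((K ^ 2 + 1) * ‖v - u₀‖ ^ 2) := by gcongr
      _ = c * ‖v - u₀‖ ^ 2 := by field_simp
      _ ≤ _ := by linarith
  -- Away from the nearest point, compactness and uniqueness leave a positive gap.
  obtain ⟨c', hc', hfar⟩ : ∃ c' > 0, ∀ z ∈ M \ interior U,
      c' * ‖z - φ u₀‖ ^ 2 ≤ ‖z - x‖ ^ 2 - ‖φ u₀ - x‖ ^ 2 := by
    rcases (M \ interior U).eq_empty_or_nonempty with he | hne
    · exact ⟨1, one_pos, by simp [he]⟩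
    have hcomp : IsCompact (M \ interior U) := hMc.diff isOpen_interior
    obtain ⟨z₀, hz₀, hmin⟩ := hcomp.exists_isMinOn hne (f := fun z => ‖z - x‖ ^ 2) (by fun_prop)
    obtain ⟨z₁, -, hmax⟩ := hcomp.exists_isMaxOn hne (f := fun z => ‖z - φ u₀‖ ^ 2) (by fun_prop)
    have hpos : 0 < ‖z₀ - x‖ ^ 2 - ‖φ u₀ - x‖ ^ 2 := by
      by_contra! hle
      have : z₀ = φ u₀ := huniq z₀ ⟨hz₀.1, fun z hz => by linarith [hp.2 z hz]⟩
      exact hz₀.2 (this ▸ mem_interior_iff_mem_nhds.2 hU)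
    refine ⟨(‖z₀ - x‖ ^ 2 - ‖φ u₀ - x‖ ^ 2) / (‖z₁ - φ u₀‖ ^ 2 + 1), by positivity, fun z hz => ?_⟩
    have h1 : ‖z₀ - x‖ ^ 2 ≤ ‖z - x‖ ^ 2 := hmin hz
    have h2 : ‖z - φ u₀‖ ^ 2 ≤ ‖z₁ - φ u₀‖ ^ 2 := hmax hz
    rw [div_mul_eq_mul_div, div_le_iff₀ (by positivity)]
    calc _ ≤ (‖z₀ - x‖ ^ 2 - ‖φ u₀ - x‖ ^ 2) * (‖z₁ - φ u₀‖ ^ 2 + 1) := by gcongr; linarith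
      _ ≤ _ := by gcongr
  refine ⟨min (c / (K ^ 2 + 1)) c', lt_min (by positivity) hc', fun z hz => ?_⟩
  by_cases hzU : z ∈ interior U
  · exact le_trans (by gcongr; exact min_le_left _ _) (hnear z ⟨hz, interior_subset hzU⟩)
  · exact le_trans (by gcongr; exact min_le_right _ _) (hfar z ⟨hz, hzU⟩)

/-- A nearest point with quadratic growth remains a nearest point along a part of the normal ray
beyond the given point. -/
lemma exists_one_lt_forall_inner_le {c : ℝ} (hc : 0 < c)
    (h : ∀ z ∈ M, 2 * inner ℝ (x - p) (z - p) ≤ (1 - c) * ‖z - p‖ ^ 2) {b : ℝ} (hb : 1 < b) :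
    ∃ a, 1 < a ∧ a ≤ b ∧ ∀ z ∈ M, 2 * a * inner ℝ (x - p) (z - p) ≤ ‖z - p‖ ^ 2 := by
  -- The factor `1 + c` works because `(1 + c) * (1 - c) ≤ 1`.
  refine ⟨min b (1 + c), lt_min hb (by linarith), min_le_left _ _, fun z hz => ?_⟩
  have ha : min b (1 + c) ≤ 1 + c := min_le_right _ _
  have ha' : 1 < min b (1 + c) := lt_min hb (by linarith)
  set a := min b (1 + c)
  have h1 : a * (1 - c) ≤ 1 := by nlinarith
  calc 2 * a * inner ℝ (x - p) (z - p) = a * (2 * inner ℝ (x - p) (z - p)) := by ring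
    _ ≤ a * ((1 - c) * ‖z - p‖ ^ 2) := mul_le_mul_of_nonneg_left (h z hz) (by linarith)
    _ = (a * (1 - c)) * ‖z - p‖ ^ 2 := by ring
    _ ≤ 1 * ‖z - p‖ ^ 2 := by gcongr
    _ = _ := one_mul _

/-- The nearest point of `x` remains a nearest point along the normal ray through `x` as long as
this ray does not meet the cutlocus. -/
lemma forall_inner_le_of_disjoint_ball (hMc : IsCompact M) {r : ℝ}
    (hr : Disjoint (Metric.ball x r) (cutLocus m M)) (hp : IsNearestPoint M x p) {Λ : ℝ}
    (hΛ : 1 ≤ Λ) (hΛr : (Λ - 1) * ‖x - p‖ < r) :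
    ∀ z ∈ M, 2 * Λ * inner ℝ (x - p) (z - p) ≤ ‖z - p‖ ^ 2 := by
  set S : Set ℝ := {a | ∀ z ∈ M, 2 * a * inner ℝ (x - p) (z - p) ≤ ‖z - p‖ ^ 2} with hS
  have hScl : IsClosed S := by
    simp only [hS, Set.ofPred_forall]
    exact isClosed_biInter fun z _ => isClosed_le (by fun_prop) (by fun_prop)
  -- Continuous induction on `[1, Λ]`: `S` is closed, and it remains to exceed each of its points `a
  -- < Λ`.
  refine IsClosed.Icc_subset_of_forall_exists_gt (hScl.inter isClosed_Icc) (a := 1) (b := Λ) ?_ ?_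
    (Set.right_mem_Icc.2 hΛ)
  · intro z hz
    simpa using (isNearestPoint_iff.1 hp).2 z hz
  · rintro a ⟨haS, ha1, haΛ⟩ b (hab : a < b)
    have ha0 : 0 < a := by linarith
    set x' := p + a • (x - p) with hx'
    have hx'p : x' - p = a • (x - p) := by simp [hx']
    have hx'C : x' ∉ cutLocus m M := by
      refine Set.disjoint_left.1 hr ?_
      rw [mem_ball_iff_norm, show x' - x = (a - 1) • (x - p) by rw [hx']; module, norm_smul,
        Real.norm_eq_abs, abs_of_nonneg (by linarith)]
      exact lt_of_le_of_lt (by gcongr) hΛr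
    have hpx' : IsNearestPoint M x' p := isNearestPoint_iff.2 ⟨hp.1, fun z hz => by
      rw [hx'p, real_inner_smul_left, ← mul_assoc]; exact haS z hz⟩
    obtain ⟨p', -, huniq, hnd⟩ := notMem_cutLocus_iff.1 hx'C
    obtain rfl := huniq p hpx'
    obtain ⟨c, hc, hgrow⟩ := exists_quadratic_growth hMc hpx' huniq hnd
    obtain ⟨e, he, heb, hez⟩ := exists_one_lt_forall_inner_le hc hgrow
      (b := b / a) ((one_lt_div ha0).2 hab)
    refine ⟨e * a, fun z hz => ?_, ?_, ?_⟩
    · have := hez z hz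
      rw [hx'p, real_inner_smul_left] at this
      linarith
    · nlinarith
    · rwa [le_div_iff₀ ha0] at heb

/-- Lipschitz estimate for the nearest point mapping at a point of distance at least `r` from the
cutlocus. -/
lemma norm_sub_le_of_disjoint_ball (hMc : IsCompact M) {r D : ℝ} (hr0 : 0 < r) (hD : 0 < D)
    (hr : Disjoint (Metric.ball x r) (cutLocus m M)) (hp : IsNearestPoint M x p)
    (hpD : ‖x - p‖ ≤ D) {x' p' : EuclideanSpace ℝ (Fin s)} (hp' : IsNearestPoint M x' p') :
    ‖p' - p‖ ≤ 2 * (1 + 2 * D * r⁻¹) * ‖x' - x‖ := by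
  -- This `Λ` overshoots `x` by at most `r / 2`, so the segment stays inside the ball.
  have hΛ : 1 ≤ 1 + r / (2 * D) := le_add_of_nonneg_right (by positivity)
  have h := forall_inner_le_of_disjoint_ball hMc hr hp hΛ (by
    calc (1 + r / (2 * D) - 1) * ‖x - p‖ ≤ (1 + r / (2 * D) - 1) * D := by
          gcongr
      _ = r / 2 := by field_simp; ring
      _ < r := by linarith) p' hp'.1
  have h2 := norm_sub_le_of_inner_le (by linarith) h (hp'.2 p hp.1)
  have h3 : 1 - (1 + r / (2 * D))⁻¹ = (1 + 2 * D * r⁻¹)⁻¹ := by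
    field_simp
    ring
  rw [h3, inv_mul_eq_div, div_le_iff₀ (by positivity)] at h2
  linarith

/-- The cutlocus of a compact submanifold is closed. -/
lemma isClosed_cutLocus (hMc : IsCompact M) : IsClosed (cutLocus m M) := by
  rw [← isOpen_compl_iff, isOpen_iff_eventually]
  intro x hx
  obtain ⟨p, hp, huniq, hnd⟩ := notMem_cutLocus_iff.1 hx
  obtain ⟨c, hc, hgrow⟩ := exists_quadratic_growth hMc hp huniq hnd
  obtain ⟨a, ha, -, hray⟩ := exists_one_lt_forall_inner_le hc hgrow one_lt_two
  obtain ⟨φ, V, hφ, u₀, hu₀, rfl, hnd⟩ := hnd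
  have hsm := hφ.contDiffAt_sqDist hu₀ x
  obtain ⟨k, hk, hH⟩ := (hφ.isLocalMin_sqDist hu₀ hp).exists_coercive_fderiv_fderiv hsm hnd
  set F := fun y => fderiv ℝ ((fun z => ‖z - y‖ ^ 2) ∘ φ) with hF
  set H := fderiv ℝ (F x) u₀ with hHdef
  have hstrict : HasStrictFDerivAt (F x) H u₀ :=
    (hsm.fderiv_right (m := 1) (by norm_num)).hasStrictFDerivAt (by norm_num)
  obtain ⟨N₁, hN₁, happrox⟩ := hstrict.approximates_deriv_on_nhds (c := (k / 4).toNNReal)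
    (Or.inr (Real.toNNReal_pos.2 (by positivity)))
  have hDφ : ContDiffAt ℝ 1 (fderiv ℝ φ) u₀ :=
    (hφ.contDiffAt hu₀).fderiv_right (by norm_num)
  obtain ⟨K, N₂, hN₂, hlip⟩ := (hDφ.hasStrictFDerivAt (by norm_num)).exists_lipschitzOnWith
  set N := interior (V ∩ N₁ ∩ N₂)
  have hN : N ∈ 𝓝 u₀ :=
    interior_mem_nhds.2 (inter_mem (inter_mem (hφ.isOpen.mem_nhds hu₀) hN₁) hN₂)
  obtain ⟨U, hU, hMU⟩ := hφ.exists_inter_subset_image hu₀ hN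
  -- For `y` near `x`, the differential `F y` is `k / 2`-close to the linear map `H`, which is
  -- coercive with constant `k`. One `k / 4` comes from strict differentiability of `F x`, the other
  -- from moving the centre.
  have hLip : ∀ y, ‖x - y‖ * (2 * K) ≤ k / 4 → ∀ u ∈ N, ∀ v ∈ N,
      ‖F y u - F y v - H (u - v)‖ ≤ k / 2 * ‖u - v‖ := by
    intro y hy u hu v hv
    obtain ⟨⟨huV, hu1⟩, hu2⟩ := interior_subset hu
    obtain ⟨⟨hvV, hv1⟩, hv2⟩ := interior_subset hv
    have h1 : ‖F x u - F x v - H (u - v)‖ ≤ k / 4 * ‖u - v‖ := by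
      rw [← Real.coe_toNNReal (k / 4) (by positivity)]
      exact happrox u hu1 v hv1
    have h2 : ‖fderiv ℝ φ u - fderiv ℝ φ v‖ ≤ K * ‖u - v‖ := by
      simpa [dist_eq_norm] using hlip.dist_le_mul u hu2 v hv2
    have h3 : F y u - F y v - H (u - v) = (F x u - F x v - H (u - v)) +
        (2 • innerSL ℝ (x - y)) ∘SL (fderiv ℝ φ u - fderiv ℝ φ v) := by
      simp only [hF, hφ.fderiv_sqDist_eq huV x y, hφ.fderiv_sqDist_eq hvV x y,
        ContinuousLinearMap.comp_sub]
      abel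
    have h4 : ‖(2 • innerSL ℝ (x - y)) ∘SL (fderiv ℝ φ u - fderiv ℝ φ v)‖ ≤
        k / 4 * ‖u - v‖ :=
      calc _ ≤ ‖2 • innerSL ℝ (x - y)‖ * ‖fderiv ℝ φ u - fderiv ℝ φ v‖ :=
            ContinuousLinearMap.opNorm_comp_le _ _
        _ ≤ (2 * ‖x - y‖) * (K * ‖u - v‖) := by
            gcongr
            refine norm_nsmul_le.trans_eq ?_
            rw [innerSL_apply_norm, Nat.cast_ofNat]
        _ = ‖x - y‖ * (2 * K) * ‖u - v‖ := by ring
        _ ≤ _ := by gcongr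
    rw [h3]
    linarith [norm_add_le (F x u - F x v - H (u - v))
      ((2 • innerSL ℝ (x - y)) ∘SL (fderiv ℝ φ u - fderiv ℝ φ v))]
  have hev1 : ∀ᶠ y in 𝓝 x, ‖x - y‖ * (2 * K) ≤ k / 4 := by
    have : ContinuousAt (fun y => ‖x - y‖ * (2 * K)) x := by fun_prop
    exact (this.eventually_lt continuousAt_const (by simpa using hk)).mono fun y hy => hy.le
  obtain ⟨δ, hδ, hball⟩ := Metric.mem_nhds_iff.1 hU
  have hev2 : ∀ᶠ y in 𝓝 x, 2 * ‖y - x‖ < (1 - a⁻¹) * δ := by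
    have h1 : ContinuousAt (fun y => 2 * ‖y - x‖) x := by fun_prop
    have h2 : 0 < 1 - a⁻¹ := sub_pos.2 (inv_lt_one_of_one_lt₀ ha)
    exact h1.eventually_lt continuousAt_const (by simpa using mul_pos h2 hδ)
  filter_upwards [hev1, hev2] with y hy1 hy2
  -- The room left on the ray beyond `x` forces all nearest points of `y` into the chart.
  have hloc : ∀ q, IsNearestPoint M y q → ∃ u ∈ V ∩ N, φ u = q := by
    intro q hq
    refine hMU ⟨hq.1, hball ?_⟩
    have h1 := norm_sub_le_of_inner_le (by linarith) (hray q hq.1) (hq.2 _ hp.1)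
    have h2 : 0 < 1 - a⁻¹ := sub_pos.2 (inv_lt_one_of_one_lt₀ ha)
    rw [mem_ball_iff_norm]
    exact lt_of_mul_lt_mul_left (h1.trans_lt hy2) h2.le
  have hcrit : ∀ u ∈ V, IsNearestPoint M y (φ u) → F y u = 0 := fun u hu hq =>
    (hφ.isLocalMin_sqDist hu hq).fderiv_eq_zero
  obtain ⟨q, hq⟩ := exists_isNearestPoint hMc ⟨_, hp.1⟩ y
  obtain ⟨u, ⟨huV, huN⟩, rfl⟩ := hloc q hq
  refine notMem_cutLocus_iff.2 ⟨φ u, hq, fun q' hq' => ?_, φ, V, hφ, u, huV, rfl, fun v hv => ?_⟩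
  · obtain ⟨u', ⟨huV', huN'⟩, rfl⟩ := hloc q' hq'
    -- Both parameters are zeros of `F y`, so `k * ‖u' - u‖ ^ 2 ≤ k / 2 * ‖u' - u‖ ^ 2`.
    have h1 := hLip y hy1 u' huN' u huN
    rw [hcrit u huV hq, hcrit u' huV' hq', sub_zero, zero_sub, norm_neg] at h1
    have h2 : H (u' - u) (u' - u) ≤ k / 2 * ‖u' - u‖ * ‖u' - u‖ :=
      (le_abs_self _).trans (((H (u' - u)).le_opNorm _).trans (by gcongr))
    have h3 : ‖u' - u‖ ^ 2 ≤ 0 := by nlinarith [hH (u' - u)]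
    have h4 : u' - u = 0 := by simpa using le_antisymm h3 (by positivity)
    rw [sub_eq_zero.1 h4]
  · have hd : HasFDerivAt (F y) (fderiv ℝ (F y) u) u :=
      (((hφ.contDiffAt_sqDist huV y).fderiv_right (m := 1) (by norm_num)).differentiableAt
        (by norm_num)).hasFDerivAt
    -- The Hessian at `u` is within `k / 2` of `H`, so coercivity survives.
    have h1 : ‖fderiv ℝ (F y) u - H‖ ≤ k / 2 := by
      refine (hd.sub H.hasFDerivAt).le_of_lip' (by positivity) ?_
      filter_upwards [isOpen_interior.mem_nhds huN] with v hv
      have := hLip y hy1 v hv u huN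
      rwa [map_sub, sub_sub_sub_comm] at this
    have h2 : -(fderiv ℝ (F y) u - H) v v ≤ k / 2 * ‖v‖ * ‖v‖ :=
      (neg_le_abs _).trans (((fderiv ℝ (F y) u - H).le_opNorm₂ v v).trans (by gcongr))
    have h3 : (fderiv ℝ (F y) u - H) v v = - H v v := by
      rw [sub_apply, sub_apply, show fderiv ℝ (F y) u v v = 0 from hv v, zero_sub]
    have h4 : ‖v‖ ^ 2 ≤ 0 := by nlinarith [hH v]
    simpa using le_antisymm h4 (by positivity)

end Submanifold

/-! ### Tightness and the probabilistic conclusion. -/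

section Probability

/-- Random vectors that converge in distribution are bounded in probability. -/
lemma MeasureTheory.TendstoInDistribution.exists_eventually_measure_norm_ge_lt
    {E : Type*} [NormedAddCommGroup E] [MeasurableSpace E] [BorelSpace E]
    {Ω : ℕ → Type*} [∀ n, MeasurableSpace (Ω n)]
    {P : ∀ n, Measure (Ω n)} [∀ n, IsProbabilityMeasure (P n)]
    {Ω' : Type*} [MeasurableSpace Ω'] {P' : Measure Ω'} [IsProbabilityMeasure P']
    {X : ∀ n, Ω n → E} {Z : Ω' → E} (h : TendstoInDistribution X atTop Z P P')
    {η : ENNReal} (hη : 0 < η) :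
    ∃ K : ℝ, 0 < K ∧ ∀ᶠ n in atTop, P n {ω | K ≤ ‖X n ω‖} < η := by
  have hcl : ∀ K : ℝ, IsClosed {w : E | K ≤ ‖w‖} := fun K =>
    isClosed_le continuous_const continuous_norm
  have hlim : Tendsto (P'.map Z ∘ fun k : ℕ => {w : E | (k : ℝ) ≤ ‖w‖}) atTop
      (𝓝 (P'.map Z (⋂ k : ℕ, {w : E | (k : ℝ) ≤ ‖w‖}))) := by
    have := Measure.isProbabilityMeasure_map (μ := P') h.aemeasurable_limit
    refine tendsto_measure_iInter_atTop (fun k => (hcl k).measurableSet.nullMeasurableSet) ?_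
      ⟨0, measure_ne_top _ _⟩
    intro a b hab w hw
    exact (Nat.cast_le.2 hab).trans (show (b : ℝ) ≤ ‖w‖ from hw)
  have hempty : (⋂ k : ℕ, {w : E | (k : ℝ) ≤ ‖w‖}) = ∅ := by
    refine Set.eq_empty_of_forall_notMem fun w hw => ?_
    obtain ⟨k, hk⟩ := exists_nat_gt ‖w‖
    exact absurd (Set.mem_iInter.1 hw k) (not_le.2 hk)
  rw [hempty, measure_empty] at hlim
  obtain ⟨k, hk, hk0⟩ := ((hlim.eventually_lt_const hη).and (eventually_gt_atTop 0)).exists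
  refine ⟨k, Nat.cast_pos.2 hk0, ?_⟩
  -- Portmanteau inequality for the closed tail set.
  have hls := ProbabilityMeasure.limsup_measure_closed_le_of_tendsto h.tendsto (hcl k)
  filter_upwards [eventually_lt_of_limsup_lt (hls.trans_lt hk)] with n hn
  rwa [ProbabilityMeasure.coe_mk,
    Measure.map_apply_of_aemeasurable (h.forall_aemeasurable n) (hcl k).measurableSet] at hn

end Probability

lemma Matrix.tendsto_norm_toEuclideanCLM {ι : Type*} {l : Filter ι} {s : ℕ}
    {A : ι → Matrix (Fin s) (Fin s) ℝ} (hA : Tendsto A l (𝓝 0)) :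
    Tendsto (fun i => ‖Matrix.toEuclideanCLM (n := Fin s) (𝕜 := ℝ) (A i)‖) l (𝓝 0) := by
  have hcont : Continuous (Matrix.toEuclideanCLM (n := Fin s) (𝕜 := ℝ)) :=
    LinearMap.continuous_of_finiteDimensional
      (Matrix.toEuclideanCLM (n := Fin s) (𝕜 := ℝ)).toAlgEquiv.toLinearMap
  simpa using ((hcont.tendsto 0).comp hA).norm

/-- Consistency of the projected estimator when `t n` is at distance at least `r n` from the
cutlocus. -/
lemma tendsto_measure_nearestPoint_sub {s m : ℕ} {M : Set (EuclideanSpace ℝ (Fin s))}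
    (hMc : IsCompact M)
    {Ω : ℕ → Type*} [∀ n, MeasurableSpace (Ω n)]
    {P : ∀ n, Measure (Ω n)} [∀ n, IsProbabilityMeasure (P n)]
    {Ω' : Type*} [MeasurableSpace Ω'] {P' : Measure Ω'} [IsProbabilityMeasure P']
    {t : ℕ → EuclideanSpace ℝ (Fin s)} {tt : ∀ n, Ω n → EuclideanSpace ℝ (Fin s)}
    {Z : Ω' → EuclideanSpace ℝ (Fin s)} {B : ℕ → Matrix (Fin s) (Fin s) ℝ}
    (hBdet : ∀ n, IsUnit (B n).det) (hB : Tendsto B atTop (𝓝 0))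
    (hZ : TendstoInDistribution
      (fun n ω => Matrix.toEuclideanCLM (n := Fin s) (𝕜 := ℝ) (B n)⁻¹ (tt n ω - t n))
      atTop Z P P')
    (hne : M.Nonempty) {D : ℝ} (hD : 0 < D) (htD : ∀ n, Metric.infDist (t n) M ≤ D)
    {r : ℕ → ℝ} (hr0 : ∀ n, 0 < r n)
    (hr : ∀ n, Disjoint (Metric.ball (t n) (r n)) (cutLocus m M))
    (hBr : Tendsto (fun n => (r n)⁻¹ • B n) atTop (𝓝 0))
    {μt : ∀ n, Ω n → EuclideanSpace ℝ (Fin s)}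
    (hμt : ∀ n ω, tt n ω ∉ cutLocus m M → μt n ω = nearestPoint M (tt n ω))
    {ε : ℝ} (hε : 0 < ε) :
    Tendsto (fun n => P n {ω | ε ≤ ‖μt n ω - nearestPoint M (t n)‖}) atTop (𝓝 0) := by
  set T := fun n => Matrix.toEuclideanCLM (n := Fin s) (𝕜 := ℝ) (B n) with hT
  have hTB : Tendsto (fun n => ‖T n‖) atTop (𝓝 0) := Matrix.tendsto_norm_toEuclideanCLM hB
  have hTr : Tendsto (fun n => (r n)⁻¹ * ‖T n‖) atTop (𝓝 0) := by
    refine (Matrix.tendsto_norm_toEuclideanCLM hBr).congr fun n => ?_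
    rw [map_smul, norm_smul, Real.norm_eq_abs, abs_of_pos (inv_pos.2 (hr0 n))]
  refine ENNReal.tendsto_nhds_zero.2 fun η hη => ?_
  obtain ⟨K, hK, hKn⟩ := hZ.exists_eventually_measure_norm_ge_lt hη
  -- `hev1` will keep `tt n ω` in the ball free of the cutlocus; `hev2` makes the Lipschitz bound
  -- smaller than `ε`.
  have hev1 : ∀ᶠ n in atTop, (r n)⁻¹ * ‖T n‖ * K < 1 :=
    (hTr.mul_const K).eventually_lt_const (by simp)
  have hev2 : ∀ᶠ n in atTop, 2 * (‖T n‖ + 2 * D * ((r n)⁻¹ * ‖T n‖)) * K < ε := by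
    have : Tendsto (fun n => 2 * (‖T n‖ + 2 * D * ((r n)⁻¹ * ‖T n‖)) * K) atTop (𝓝 0) := by
      simpa using ((hTB.add (hTr.const_mul (2 * D))).const_mul 2).mul_const K
    exact this.eventually_lt_const hε
  filter_upwards [hKn, hev1, hev2] with n hn h1 h2
  -- Monotonicity holds for outer measure, so `μt n` need not be measurable.
  refine le_trans (measure_mono fun ω (hω : ε ≤ _) => ?_) hn.le
  rw [Set.mem_ofPred_eq]
  by_contra! hlt
  set w := Matrix.toEuclideanCLM (n := Fin s) (𝕜 := ℝ) (B n)⁻¹ (tt n ω - t n) with hw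
  have hTw : T n w = tt n ω - t n := by
    rw [hw, hT, ← mul_apply_eq_comp, ← map_mul, Matrix.mul_nonsing_inv _ (hBdet n),
      map_one, one_apply_eq_self]
  have hdist : ‖tt n ω - t n‖ ≤ ‖T n‖ * K := by
    rw [← hTw]
    exact ((T n).le_opNorm w).trans (by gcongr)
  have hball : tt n ω ∈ Metric.ball (t n) (r n) := by
    rw [mem_ball_iff_norm]
    refine hdist.trans_lt ?_
    rw [mul_assoc, inv_mul_lt_iff₀ (hr0 n), mul_one] at h1
    exact h1
  rw [hμt n ω (Set.disjoint_left.1 (hr n) hball)] at hω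
  have hp := isNearestPoint_nearestPoint hMc hne (t n)
  have hpD : ‖t n - nearestPoint M (t n)‖ ≤ D := by
    refine le_trans ((Metric.le_infDist hne).2 fun z hz => ?_) (htD n)
    rw [dist_eq_norm, norm_sub_rev, norm_sub_rev (t n)]
    exact le_of_sq_le_sq (hp.2 z hz) (norm_nonneg _)
  have hle := norm_sub_le_of_disjoint_ball hMc (hr0 n) hD (hr n) hp hpD
    (isNearestPoint_nearestPoint hMc hne (tt n ω))
  have hrn : 0 < (r n)⁻¹ := inv_pos.2 (hr0 n)
  have := calc ε ≤ 2 * (1 + 2 * D * (r n)⁻¹) * ‖tt n ω - t n‖ := hω.trans hle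
    _ ≤ 2 * (1 + 2 * D * (r n)⁻¹) * (‖T n‖ * K) := by gcongr
    _ = 2 * (‖T n‖ + 2 * D * ((r n)⁻¹ * ‖T n‖)) * K := by ring
  linarith

/-- The random vectors `tt n` may live on different probability spaces, and `μt n`, the projected
estimator, is arbitrary on the event that `tt n` lies in the cutlocus. If the cutlocus is empty
(its distance being `+∞` by convention, and `0` for `Metric.infDist`), the rate condition holds
automatically under both conventions. -/
theorem theorem2p1 {s m : ℕ} (M : Set (EuclideanSpace ℝ (Fin s)))
    (hMc : IsCompact M) (hM : IsSubmanifold m M)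
    {Ω : ℕ → Type*} [∀ n, MeasurableSpace (Ω n)]
    (P : ∀ n, Measure (Ω n)) [∀ n, IsProbabilityMeasure (P n)]
    {Ω' : Type*} [MeasurableSpace Ω'] (P' : Measure Ω') [IsProbabilityMeasure P']
    (t : ℕ → EuclideanSpace ℝ (Fin s))
    (tt : ∀ n, Ω n → EuclideanSpace ℝ (Fin s))
    (Z : Ω' → EuclideanSpace ℝ (Fin s))
    (B : ℕ → Matrix (Fin s) (Fin s) ℝ)
    (hBdet : ∀ n, IsUnit (B n).det)
    (hB : Tendsto B atTop (𝓝 0))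
    (hZ : TendstoInDistribution
      (fun n ω => Matrix.toEuclideanCLM (n := Fin s) (𝕜 := ℝ) (B n)⁻¹ (tt n ω - t n))
      atTop Z P P')
    (ht : ∀ n, t n ∉ cutLocus m M)
    (D : ℝ) (hD : 0 < D) (htD : ∀ n, Metric.infDist (t n) M ≤ D)
    (hBC : Tendsto (fun n => (Metric.infDist (t n) (cutLocus m M))⁻¹ • B n) atTop (𝓝 0))
    (μt : ∀ n, Ω n → EuclideanSpace ℝ (Fin s))
    (hμt : ∀ n ω, tt n ω ∉ cutLocus m M → μt n ω = nearestPoint M (tt n ω)) :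
    ∀ ε : ℝ, 0 < ε →
      Tendsto (fun n => P n {ω | ε ≤ ‖μt n ω - nearestPoint M (t n)‖}) atTop (𝓝 0) := by
  intro ε hε
  have hne : M.Nonempty := by
    obtain ⟨p, hp, -⟩ := notMem_cutLocus_iff.1 (ht 0)
    exact ⟨p, hp.1⟩
  rcases (cutLocus m M).eq_empty_or_nonempty with hC | hC
  -- With an empty cutlocus any fixed radius serves.
  · exact tendsto_measure_nearestPoint_sub hMc hBdet hB hZ hne hD htD (r := fun _ => 1)
      (fun _ => one_pos) (fun n => by rw [hC]; exact Set.disjoint_empty _)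
      (by simpa using hB) hμt hε
  · exact tendsto_measure_nearestPoint_sub hMc hBdet hB hZ hne hD htD
      (fun n => ((isClosed_cutLocus hMc).notMem_iff_infDist_pos hC).1 (ht n))
      (fun n => Metric.disjoint_ball_infDist) hBC hμt hε
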